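/- For a set $X$ and $n\in\mathbb N$ let $\sigma_n(2^X)=\{\chi_A : A\subseteq X,\ |A|\le n\}$, a compact subspace of the product space $\{0,1\}^X$, and let $C(K)$ denote the Banach space of real continuous functions on a compact space $K$ with the supremum norm. For compact spaces $L\subseteq K$, an extension operator is a bounded linear operator $T:C(L)\to C(K)$ such that $(Tf)|_L=f$ for all $f\in C(L)$; put $$\eta(L,K)=\inf\{\|T\| : T:C(L)\to C(K)\text{ is an extension operator}\}\in[0,\infty]$$ (with $\inf\emptyset=\infty$). Let $1\le m<n$ be integers. (1) If $|X|=\aleph_1$, then $\eta(\sigma_m(2^X),\sigma_n(2^X))=2n-2m+1$, and this infimum is attained: there is an extension operator $T:C(\sigma_m(2^X))\to C(\sigma_n(2^X))$ with $\|T\|=2n-2m+1$. (2) If $X$ is any uncountable set, then $\|T\|\ge 2n-2m+1$ for every extension operator $T:C(\sigma_m(2^X))\to C(\sigma_n(2^X))$. -/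

import Mathlib

open scoped ENNReal

/-- A bounded linear operator `T : C(L) → C(K)`, where `L ⊆ K` are compact subsets of a
topological space, is an extension operator if `T f` extends `f` for every `f ∈ C(L)`. -/
def IsExtensionOperator {E : Type*} [TopologicalSpace E] {L K : Set E}
    [CompactSpace L] [CompactSpace K] (h : L ⊆ K) (T : C(L, ℝ) →L[ℝ] C(K, ℝ)) : Prop :=
  ∀ (f : C(L, ℝ)) (x : L), T f (Set.inclusion h x) = f x

/-- `η(L, K)`: the infimum of the norms of all extension operators `C(L) → C(K)`, as an extended
nonnegative real; it is `∞` if there is no extension operator. -/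
noncomputable def eta {E : Type*} [TopologicalSpace E] {L K : Set E}
    [CompactSpace L] [CompactSpace K] (h : L ⊆ K) : ℝ≥0∞ :=
  ⨅ (T : C(L, ℝ) →L[ℝ] C(K, ℝ)) (_ : IsExtensionOperator h T), ‖T‖ₑ

/-- `σ_n(2^X)`: the points of the product `{0,1}^X` (with `true` for `1`, `Bool` discrete) that are
characteristic functions of sets of cardinality at most `n`. -/
def sigmaSpace (n : ℕ) (X : Type*) : Set (X → Bool) :=
  {x | {i | x i = true}.encard ≤ n}

theorem sigmaSpace_mono {m n : ℕ} (h : m ≤ n) (X : Type*) : sigmaSpace m X ⊆ sigmaSpace n X :=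
  fun _ hx => le_trans (show _ ≤ (m : ℕ∞) from hx) (by exact_mod_cast h)

theorem isClosed_sigmaSpace (n : ℕ) (X : Type*) : IsClosed (sigmaSpace n X) := by
  have key : sigmaSpace n X =
      ⋂ s : {s : Finset X // s.card = n + 1}, ⋃ i ∈ s.1, {x : X → Bool | x i = false} := by
    ext x
    simp only [sigmaSpace, Set.mem_ofPred_eq, Set.mem_iInter, Set.mem_iUnion, exists_prop]
    constructor
    · rintro hx ⟨s, hs⟩
      by_contra! hne
      have hsub : (s : Set X) ⊆ {i | x i = true} := fun i hi => by
        simpa using hne i (by simpa using hi)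
      have h1 := (Set.encard_le_encard hsub).trans hx
      rw [Set.encard_coe_eq_coe_finsetCard, hs] at h1
      have h2 : n + 1 ≤ n := by exact_mod_cast h1
      omega
    · intro hx
      by_contra! hlt
      have h1 : ((n + 1 : ℕ) : ℕ∞) ≤ {i | x i = true}.encard := by
        push_cast
        exact Order.add_one_le_of_lt hlt
      obtain ⟨t, hts, htc⟩ := Set.exists_subset_encard_eq h1
      have hfin : t.Finite := Set.finite_of_encard_eq_coe htc
      have hcard : hfin.toFinset.card = n + 1 := by
        rw [hfin.encard_eq_coe_toFinset_card] at htc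
        exact_mod_cast htc
      obtain ⟨i, hi, hxi⟩ := hx ⟨hfin.toFinset, hcard⟩
      have h2 : x i = true := hts (hfin.mem_toFinset.1 hi)
      simp [hxi] at h2
  rw [key]
  refine isClosed_iInter fun s => ?_
  refine Set.Finite.isClosed_biUnion s.1.finite_toSet fun i _ => ?_
  exact isClosed_eq (continuous_apply i) continuous_const

instance sigmaSpace_compactSpace (n : ℕ) (X : Type*) : CompactSpace (sigmaSpace n X) :=
  isCompact_iff_compactSpace.1 (isClosed_sigmaSpace n X).isCompact

/-! Identify points of `σ_n(2^X)` with sets of at most `n` elements. Lower bound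
(`extensionOperator_norm_ge`): fix `C` with `m - 1` elements. By continuity, `T` of the indicators
of `{x ⊇ C ∪ {a}}` and `{x ⊇ C}` is nearly `1` near `C ∪ {a}`, on a neighbourhood given by a finite
set `F a`. A free set `S` for `F` with `n - m + 1` elements (`exists_free_finset`) puts `C ∪ S` in
all these neighbourhoods at once. Twice the sum of the first indicators over `a ∈ S`, minus the
second, has norm at most `1`, but `T` sends it to nearly `2(n - m + 1) - 1` at `C ∪ S`. Upper bound
(`exists_extensionOperator_of_injOn`): order `X` in type `ω₁` and inject each initial segment into
`ℕ` by `e a`. The value of `f` at a small set telescopes as its elements are added in increasing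
order. For larger sets, the increment at `a` is computed over only the `m - 1` predecessors that
come first under `e a`. Each element beyond the `m`-th costs at most `2‖f‖`. -/

/-- The point of `{0,1}^X` that is the characteristic function of a finite set. -/
noncomputable def finsetChar {X : Type*} (s : Finset X) : X → Bool :=
  open Classical in fun i => decide (i ∈ s)

theorem finsetChar_eq_true {X : Type*} {s : Finset X} {i : X} :
    finsetChar s i = true ↔ i ∈ s := by
  simp [finsetChar]

theorem finsetChar_apply_eq_iff {X : Type*} {s t : Finset X} {i : X} :
    finsetChar s i = finsetChar t i ↔ (i ∈ s ↔ i ∈ t) := by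
  simp [finsetChar]

theorem finsetChar_mem_sigmaSpace {X : Type*} {n : ℕ} {s : Finset X} (h : s.card ≤ n) :
    finsetChar s ∈ sigmaSpace n X := by
  have : {i | finsetChar s i = true} = (s : Set X) := by
    ext i; simp [finsetChar_eq_true]
  simp only [sigmaSpace, Set.mem_ofPred_eq, this, Set.encard_coe_eq_coe_finsetCard]
  exact_mod_cast h

theorem finite_of_mem_sigmaSpace {X : Type*} {n : ℕ} {x : X → Bool} (h : x ∈ sigmaSpace n X) :
    {i | x i = true}.Finite :=
  Set.finite_of_encard_le_coe (k := n) h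

/-- The finite set of which a point of `σ_n(2^X)` is the characteristic function. -/
noncomputable def sigmaSupport {X : Type*} {n : ℕ} (x : sigmaSpace n X) : Finset X :=
  (finite_of_mem_sigmaSpace x.2).toFinset

theorem mem_sigmaSupport {X : Type*} {n : ℕ} {x : sigmaSpace n X} {i : X} :
    i ∈ sigmaSupport x ↔ x.1 i = true := by
  simp [sigmaSupport]

theorem card_sigmaSupport_le {X : Type*} {n : ℕ} (x : sigmaSpace n X) :
    (sigmaSupport x).card ≤ n := by
  have h : {i | x.1 i = true}.encard ≤ n := x.2
  rw [(finite_of_mem_sigmaSpace x.2).encard_eq_coe_toFinset_card] at h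
  exact_mod_cast h

theorem finsetChar_sigmaSupport {X : Type*} {n : ℕ} (x : sigmaSpace n X) :
    finsetChar (sigmaSupport x) = x.1 := by
  funext i
  rw [Bool.eq_iff_iff, finsetChar_eq_true, mem_sigmaSupport]

/-! ### Topology of `σ_n(2^X)` by finite sets of coordinates. -/

/-- Neighbourhoods in `σ_n(2^X)` are detected by finitely many coordinates. -/
theorem exists_finset_of_mem_nhds {X : Type*} {n : ℕ} {x : sigmaSpace n X}
    {U : Set (sigmaSpace n X)} (hU : U ∈ nhds x) :
    ∃ F : Finset X, ∀ y : sigmaSpace n X, (∀ i ∈ F, y.1 i = x.1 i) → y ∈ U := by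
  obtain ⟨V, hVU, hV, hxV⟩ := mem_nhds_iff.1 hU
  obtain ⟨W, hW, rfl⟩ := isOpen_induced_iff.1 hV
  obtain ⟨I, u, hu, hI⟩ := isOpen_pi_iff.1 hW x.1 hxV
  refine ⟨I, fun y hy => hVU (hI fun i hi => ?_)⟩
  rw [hy i hi]
  exact (hu i hi).2

theorem cylinder_mem_nhds {X : Type*} {n : ℕ} (x : sigmaSpace n X) (F : Finset X) :
    {y : sigmaSpace n X | ∀ i ∈ F, y.1 i = x.1 i} ∈ nhds x := by
  refine IsOpen.mem_nhds ?_ (fun i _ => rfl)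
  have : {y : sigmaSpace n X | ∀ i ∈ F, y.1 i = x.1 i} =
      ⋂ i ∈ F, {y : sigmaSpace n X | y.1 i = x.1 i} := by
    ext y; simp
  rw [this]
  refine isOpen_biInter_finset fun i _ => ?_
  exact (isOpen_discrete ({x.1 i} : Set Bool)).preimage
    (f := fun y : sigmaSpace n X => y.1 i) ((continuous_apply i).comp continuous_subtype_val)

/-- Continuous functions on `σ_m(2^X)` depend on finitely many coordinates up to `ε`. -/
theorem exists_finset_dist_lt {X : Type*} {m : ℕ} (f : C(sigmaSpace m X, ℝ)) {ε : ℝ}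
    (hε : 0 < ε) :
    ∃ F : Finset X, ∀ x y : sigmaSpace m X, (∀ i ∈ F, x.1 i = y.1 i) → |f x - f y| < ε := by
  classical
  have h (x : sigmaSpace m X) : ∃ F : Finset X, ∀ y : sigmaSpace m X,
      (∀ i ∈ F, y.1 i = x.1 i) → |f y - f x| < ε / 2 := by
    obtain ⟨F, hF⟩ := exists_finset_of_mem_nhds
      (f.continuous.continuousAt (x := x) (Metric.ball_mem_nhds (f x) (half_pos hε)))
    exact ⟨F, fun y hy => by simpa [Real.dist_eq] using hF y hy⟩
  choose G hG using h
  obtain ⟨t, ht⟩ := CompactSpace.elim_nhds_subcover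
    (fun x : sigmaSpace m X => {y : sigmaSpace m X | ∀ i ∈ G x, y.1 i = x.1 i})
    fun x => cylinder_mem_nhds x (G x)
  refine ⟨t.biUnion G, fun x y hxy => ?_⟩
  have hx : x ∈ ⋃ z ∈ t, {y : sigmaSpace m X | ∀ i ∈ G z, y.1 i = z.1 i} := by
    rw [ht]; trivial
  simp only [Set.mem_iUnion] at hx
  obtain ⟨z, hz, hxz⟩ := hx
  have h1 := hG z x hxz
  have h2 := hG z y fun i hi =>
    (hxy i (Finset.mem_biUnion.2 ⟨z, hz, hi⟩)).symm.trans (hxz i hi)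
  rw [abs_lt] at h1 h2 ⊢
  constructor <;> linarith

/-! ### Free sets and the lower bound. -/

/-- A set mapping with finite values on an uncountable set has free sets of any finite size. -/
theorem exists_free_finset {X : Type*} (F : X → Finset X) (k : ℕ) {Y : Set X}
    (hY : ¬ Y.Countable) :
    ∃ S : Finset X, S.card = k ∧ (S : Set X) ⊆ Y ∧
      ∀ a ∈ S, ∀ b ∈ S, a ≠ b → b ∉ F a := by
  classical
  induction k generalizing Y with
  | zero => exact ⟨∅, by simp⟩
  | succ k ih =>
    have hinf : Y.Infinite := fun h => hY h.countable
    -- Countability lets `D` and its images be discarded before the induction hypothesis is applied;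
    -- infinitude leaves some `c ∈ D` outside the finite union of `F s`, `s ∈ S`.
    obtain ⟨D, hDY, hDinf, hDc⟩ : ∃ D ⊆ Y, D.Infinite ∧ D.Countable := by
      refine ⟨Set.range fun i : ℕ => (hinf.natEmbedding Y i : X), ?_, ?_, Set.countable_range _⟩
      · rintro _ ⟨i, rfl⟩
        exact (hinf.natEmbedding Y i).2
      · exact Set.infinite_range_of_injective
          (Subtype.val_injective.comp (hinf.natEmbedding Y).injective)
    have hc : (D ∪ ⋃ c ∈ D, (F c : Set X)).Countable :=
      hDc.union (hDc.biUnion fun c _ => (F c).countable_toSet)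
    obtain ⟨S, hScard, hSY, hS⟩ := ih (Y := Y \ (D ∪ ⋃ c ∈ D, (F c : Set X)))
      fun h => hY ((h.union hc).mono (by rw [Set.sdiff_union_self]; exact Set.subset_union_left))
    obtain ⟨c, hcD, hcS⟩ := hDinf.exists_notMem_finset (S.biUnion F)
    have hSc : ∀ s ∈ S, s ∈ Y ∧ s ∉ D ∧ s ∉ F c := fun s hs => by
      have h := hSY hs
      refine ⟨h.1, fun h' => h.2 (Or.inl h'), fun h' => h.2 (Or.inr ?_)⟩
      exact Set.mem_biUnion hcD h'
    have hcF : ∀ s ∈ S, c ∉ F s := fun s hs h => hcS (Finset.mem_biUnion.2 ⟨s, hs, h⟩)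
    refine ⟨insert c S, ?_, ?_, ?_⟩
    · rw [Finset.card_insert_of_notMem fun h => (hSc c h).2.1 hcD, hScard]
    · intro s hs
      rcases Finset.mem_insert.1 hs with rfl | hs
      exacts [hDY hcD, (hSc s hs).1]
    · intro a ha b hb hab
      rcases Finset.mem_insert.1 ha with rfl | ha <;> rcases Finset.mem_insert.1 hb with rfl | hb
      · exact absurd rfl hab
      · exact (hSc b hb).2.2
      · exact hcF a ‹_›
      · exact hS a ‹_› b hb hab

/-- The indicator function of the clopen set of all points of `σ_m(2^X)` containing `C`. -/
noncomputable def containsIndicator {X : Type*} (m : ℕ) (C : Finset X) : C(sigmaSpace m X, ℝ) where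
  toFun x := ∏ i ∈ C, if x.1 i = true then 1 else 0
  continuous_toFun := continuous_finsetProd _ fun i _ =>
    (continuous_of_discreteTopology (f := fun b : Bool => if b = true then (1 : ℝ) else 0)).comp
      ((continuous_apply i).comp continuous_subtype_val)

open Classical in
theorem containsIndicator_apply {X : Type*} {m : ℕ} (C : Finset X) (x : sigmaSpace m X) :
    containsIndicator m C x = if C ⊆ sigmaSupport x then 1 else 0 := by
  simp only [containsIndicator, ContinuousMap.coe_mk, Finset.prod_ite_zero, Finset.prod_const_one,
    Finset.subset_iff, mem_sigmaSupport]

-- A point containing `C` has room for at most one element of `S`, so the function takes only the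
-- values `0` and `±1`.
open Classical in
theorem norm_sum_containsIndicator_sub_le {X : Type*} {m : ℕ} {C S : Finset X}
    (hC : m ≤ C.card + 1) (hCS : Disjoint C S) :
    ‖2 • (∑ a ∈ S, containsIndicator m (insert a C)) - containsIndicator m C‖ ≤ 1 := by
  refine (ContinuousMap.norm_le _ zero_le_one).2 fun x => ?_
  simp only [ContinuousMap.sub_apply, ContinuousMap.smul_apply, ContinuousMap.sum_apply,
    containsIndicator_apply, Real.norm_eq_abs]
  by_cases hx : C ⊆ sigmaSupport x
  · have hsum : (∑ a ∈ S, if insert a C ⊆ sigmaSupport x then (1 : ℝ) else 0) =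
        (S ∩ sigmaSupport x).card := by
      simp only [Finset.insert_subset_iff, hx, and_true, Finset.sum_boole,
        Finset.filter_mem_eq_inter]
    have hcard : (S ∩ sigmaSupport x).card ≤ 1 := by
      have h1 : (C ∪ S ∩ sigmaSupport x).card ≤ m :=
        (Finset.card_le_card (Finset.union_subset hx Finset.inter_subset_right)).trans
          (card_sigmaSupport_le x)
      rw [Finset.card_union_of_disjoint (hCS.mono_right Finset.inter_subset_left)] at h1
      omega
    rw [hsum, if_pos hx]
    interval_cases (S ∩ sigmaSupport x).card <;> norm_num
  · have : ∀ a, ¬ insert a C ⊆ sigmaSupport x := fun a h =>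
      hx ((Finset.subset_insert a C).trans h)
    simp [hx, this]

theorem extensionOperator_norm_ge {X : Type*} [Uncountable X] {m n : ℕ} (hm : 1 ≤ m) (hmn : m < n)
    (T : C(sigmaSpace m X, ℝ) →L[ℝ] C(sigmaSpace n X, ℝ))
    (hT : IsExtensionOperator (sigmaSpace_mono hmn.le X) T) :
    2 * (n : ℝ) - 2 * (m : ℝ) + 1 ≤ ‖T‖ := by
  classical
  obtain ⟨k, rfl⟩ : ∃ k, n = m + k := ⟨n - m, by omega⟩
  obtain ⟨l, rfl⟩ : ∃ l, m = l + 1 := ⟨m - 1, by omega⟩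
  obtain ⟨C, hC⟩ := Infinite.exists_subset_card_eq X l
  -- The error is `2ε` for each of the `k + 1` elements of `S`, plus `ε` for the indicator of `C`.
  suffices h : ∀ ε > 0, (2 * (k : ℝ) + 1) - (2 * k + 3) * ε ≤ ‖T‖ by
    have hk : (0 : ℝ) < 2 * k + 3 := by positivity
    have : 2 * (k : ℝ) + 1 ≤ ‖T‖ := by
      refine le_of_forall_pos_le_add fun δ hδ => ?_
      have := h (δ / (2 * k + 3)) (by positivity)
      rw [mul_div_cancel₀ _ hk.ne'] at this
      linarith
    push_cast
    linarith
  intro ε hε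
  have hcard (a : X) : (insert a C).card ≤ l + 1 := hC ▸ Finset.card_insert_le a C
  have key (a : X) : ∃ F : Finset X, ∀ y : sigmaSpace (l + 1 + k) X,
      (∀ i ∈ F, y.1 i = finsetChar (insert a C) i) →
      |T (containsIndicator _ (insert a C)) y - 1| < ε ∧ |T (containsIndicator _ C) y - 1| < ε := by
    set x : sigmaSpace (l + 1) X := ⟨_, finsetChar_mem_sigmaSpace (hcard a)⟩ with hx
    have hxs : sigmaSupport x = insert a C := by
      ext i; rw [mem_sigmaSupport, hx, finsetChar_eq_true]
    have hball (D : Finset X) (hD : D ⊆ insert a C) :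
        {y | |T (containsIndicator _ D) y - 1| < ε} ∈
          nhds (Set.inclusion (sigmaSpace_mono hmn.le X) x) := by
      have h1 : T (containsIndicator _ D) (Set.inclusion (sigmaSpace_mono hmn.le X) x) = 1 := by
        rw [hT, containsIndicator_apply, hxs, if_pos hD]
      have h2 := (T (containsIndicator _ D)).continuous.continuousAt
        (Metric.ball_mem_nhds (T (containsIndicator _ D)
          (Set.inclusion (sigmaSpace_mono hmn.le X) x)) hε)
      rw [h1] at h2
      filter_upwards [h2] with y hy
      simpa [Real.dist_eq] using hy
    exact exists_finset_of_mem_nhds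
      (Filter.inter_mem (hball _ subset_rfl) (hball C (Finset.subset_insert a C)))
  choose F hF using key
  have hY : ¬ (C : Set X)ᶜ.Countable := fun h =>
    Set.not_countable_univ ((C.countable_toSet.union h).mono (by rw [Set.union_compl_self]))
  obtain ⟨S, hScard, hSC, hS⟩ := exists_free_finset F (k + 1) hY
  have hdisj : Disjoint C S := Finset.disjoint_left.2 fun i hi hi' => hSC hi' hi
  have hyc : (C ∪ S).card ≤ l + 1 + k := by
    rw [Finset.card_union_of_disjoint hdisj, hC, hScard]; omega
  set y : sigmaSpace (l + 1 + k) X := ⟨_, finsetChar_mem_sigmaSpace hyc⟩ with hy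
  -- Freeness: `F a` meets `S` at most in `a`, so it cannot tell `C ∪ S` from `C ∪ {a}`.
  have hyF : ∀ a ∈ S, ∀ i ∈ F a, y.1 i = finsetChar (insert a C) i := fun a ha i hi => by
    rw [hy, finsetChar_apply_eq_iff, Finset.mem_union, Finset.mem_insert]
    constructor
    · rintro (h | h)
      · exact Or.inr h
      · by_contra! hne
        exact hS a ha i h hne.1.symm hi
    · rintro (rfl | h)
      exacts [Or.inr ha, Or.inl h]
  obtain ⟨a, ha⟩ : S.Nonempty := Finset.card_pos.1 (by omega)
  have h1 := (abs_lt.1 (hF a y (hyF a ha)).2).2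
  have h2 : ((k : ℝ) + 1) * (1 - ε) ≤
      ∑ a ∈ S, T (containsIndicator (l + 1) (insert a C)) y := by
    have : ∀ a ∈ S, 1 - ε ≤ T (containsIndicator (l + 1) (insert a C)) y := fun a ha => by
      linarith [(abs_lt.1 (hF a y (hyF a ha)).1).1]
    have := Finset.card_nsmul_le_sum S _ _ this
    rw [hScard, nsmul_eq_mul] at this
    exact_mod_cast this
  have h3 := T.le_opNorm_of_le (norm_sum_containsIndicator_sub_le (m := l + 1) (by omega) hdisj)
  have h4 := ((le_abs_self _).trans ((Real.norm_eq_abs _).symm.trans_le (ContinuousMap.norm_coe_le_norm _ y))).trans h3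
  rw [map_sub, map_nsmul, map_sum, ContinuousMap.sub_apply, ContinuousMap.smul_apply,
    ContinuousMap.sum_apply, nsmul_eq_mul, mul_one, Nat.cast_ofNat] at h4
  linarith

/-! ### The extension operator built from the injections `e a`. -/

/-- The value of a function on `σ_m(2^X)` at a finite set, and `0` at sets that are too large. -/
noncomputable def sigmaValue {X : Type*} {m : ℕ} (f : C(sigmaSpace m X, ℝ)) (s : Finset X) : ℝ :=
  open Classical in if h : s.card ≤ m then f ⟨finsetChar s, finsetChar_mem_sigmaSpace h⟩ else 0

theorem sigmaValue_of_card_le {X : Type*} {m : ℕ} (f : C(sigmaSpace m X, ℝ)) {s : Finset X}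
    (h : s.card ≤ m) :
    sigmaValue f s = f ⟨finsetChar s, finsetChar_mem_sigmaSpace h⟩ :=
  dif_pos h

theorem abs_sigmaValue_le {X : Type*} {m : ℕ} (f : C(sigmaSpace m X, ℝ)) (s : Finset X) :
    |sigmaValue f s| ≤ ‖f‖ := by
  unfold sigmaValue
  split_ifs
  · exact f.norm_coe_le_norm _
  · simp

theorem sigmaValue_add {X : Type*} {m : ℕ} (f g : C(sigmaSpace m X, ℝ)) (s : Finset X) :
    sigmaValue (f + g) s = sigmaValue f s + sigmaValue g s := by
  unfold sigmaValue
  split_ifs <;> simp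

theorem sigmaValue_smul {X : Type*} {m : ℕ} (c : ℝ) (f : C(sigmaSpace m X, ℝ)) (s : Finset X) :
    sigmaValue (c • f) s = c * sigmaValue f s := by
  unfold sigmaValue
  split_ifs <;> simp

section Ladder

variable {X : Type*} [LinearOrder X] (e : X → X → ℕ) (m : ℕ)

/-- The first `m - 1` elements of `{b ∈ A | b < a}` in the order given by `e a`. -/
def initialPart (A : Finset X) (a : X) : Finset X :=
  {b ∈ A | b < a ∧ {c ∈ A | c < a ∧ e a c < e a b}.card < m - 1}

theorem initialPart_subset (A : Finset X) (a : X) : initialPart e m A a ⊆ A :=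
  Finset.filter_subset _ _

/-- Injectivity of `e a` makes the rank of a predecessor determine it, and only ranks below `m - 1`
are admitted. -/
theorem card_initialPart_le {e : X → X → ℕ} (he : ∀ a, Set.InjOn (e a) {b | b < a})
    (A : Finset X) (a : X) : (initialPart e m A a).card ≤ m - 1 := by
  refine (Finset.card_le_card_of_injOn (t := Finset.range (m - 1))
    (fun b => {c ∈ A | c < a ∧ e a c < e a b}.card) ?_ ?_).trans (Finset.card_range _).le
  · intro b hb
    simp only [initialPart, Finset.coe_filter, Set.mem_ofPred_eq] at hb
    simpa using hb.2.2
  · have key : ∀ b ∈ initialPart e m A a, ∀ c, e a b < e a c →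
        {d ∈ A | d < a ∧ e a d < e a b}.card < {d ∈ A | d < a ∧ e a d < e a c}.card := by
      intro b hb c hbc
      simp only [initialPart, Finset.mem_filter] at hb
      refine Finset.card_lt_card ⟨fun d hd => ?_, fun h => ?_⟩
      · simp only [Finset.mem_filter] at hd ⊢
        exact ⟨hd.1, hd.2.1, hd.2.2.trans hbc⟩
      · have := h (Finset.mem_filter.2 ⟨hb.1, hb.2.1, hbc⟩)
        simp at this
    intro b hb c hc hbc
    have hb' := (Finset.mem_filter.1 hb).2.1
    have hc' := (Finset.mem_filter.1 hc).2.1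
    rcases lt_trichotomy (e a b) (e a c) with h | h | h
    · exact absurd hbc (key b hb c h).ne
    · exact he a hb' hc' h
    · exact absurd hbc (key c hc b h).ne'

theorem initialPart_eq_of_card_le {A : Finset X} {a : X} (hA : ∀ b ∈ A, b < a)
    (h : A.card ≤ m - 1) : initialPart e m A a = A := by
  refine Finset.filter_true_of_mem fun b hb => ⟨hA b hb, lt_of_lt_of_le ?_ h⟩
  exact Finset.card_lt_card ⟨Finset.filter_subset _ _, fun h => by simpa using h hb⟩

theorem initialPart_insert_of_le {A : Finset X} {a y : X} (h : a ≤ y) :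
    initialPart e m (insert y A) a = initialPart e m A a := by
  simp only [initialPart, Finset.filter_insert, h.not_gt, false_and, if_false]

/-- The value at the finite set `A` of the extension of `f`. -/
noncomputable def ladderSum (f : C(sigmaSpace m X, ℝ)) (A : Finset X) : ℝ :=
  sigmaValue f ∅ + ∑ a ∈ A, (sigmaValue f (insert a (initialPart e m A a)) -
    sigmaValue f (initialPart e m A a))

theorem ladderSum_insert (f : C(sigmaSpace m X, ℝ)) {A : Finset X} {y : X} (hy : ∀ a ∈ A, a < y) :
    ladderSum e m f (insert y A) = ladderSum e m f A +
      (sigmaValue f (insert y (initialPart e m A y)) - sigmaValue f (initialPart e m A y)) := by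
  unfold ladderSum
  rw [Finset.sum_insert fun h => (hy y h).false, initialPart_insert_of_le e m le_rfl,
    Finset.sum_congr rfl fun a ha => by rw [initialPart_insert_of_le e m (hy a ha).le]]
  ring

/-- Every initial part consists of all the predecessors, so the sum telescopes. -/
theorem ladderSum_of_card_le (f : C(sigmaSpace m X, ℝ)) {A : Finset X} (h : A.card ≤ m) :
    ladderSum e m f A = sigmaValue f A := by
  induction A using Finset.induction_on_max with
  | empty => simp [ladderSum]
  | insert y A hy ih =>
    rw [Finset.card_insert_of_notMem fun h => (hy y h).false] at h
    rw [ladderSum_insert e m f hy, ih (by omega), initialPart_eq_of_card_le e m hy (by omega)]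
    ring

/-- Removing the maximum changes the sum by at most `2‖f‖`; after `k` removals the sum is a value of
`f`. -/
theorem abs_ladderSum_le (f : C(sigmaSpace m X, ℝ)) {A : Finset X} {k : ℕ} (h : A.card ≤ m + k) :
    |ladderSum e m f A| ≤ (2 * k + 1) * ‖f‖ := by
  induction A using Finset.induction_on_max generalizing k with
  | empty =>
    have h1 := abs_sigmaValue_le f ∅
    have h2 : 0 ≤ 2 * (k : ℝ) * ‖f‖ := by positivity
    simp only [ladderSum, Finset.sum_empty, add_zero]
    linarith
  | insert y A hy ih =>
    cases k with
    | zero =>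
      rw [ladderSum_of_card_le e m f h]
      simpa using abs_sigmaValue_le f (insert y A)
    | succ k =>
      rw [Finset.card_insert_of_notMem fun h => (hy y h).false] at h
      rw [ladderSum_insert e m f hy]
      have h0 := abs_le.1 (ih (k := k) (by omega))
      have h1 := abs_le.1 (abs_sigmaValue_le f (insert y (initialPart e m A y)))
      have h2 := abs_le.1 (abs_sigmaValue_le f (initialPart e m A y))
      push_cast
      rw [abs_le]
      constructor <;> linarith [h0.1, h0.2]

variable {e m}

/-- Sets `A` close to `B` have initial parts close to those of `B`. -/
theorem exists_finset_initialPart (he : ∀ a, Set.InjOn (e a) {b | b < a}) (B : Finset X) :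
    ∃ F : Finset X, B ⊆ F ∧ ∀ A : Finset X, (∀ i ∈ F, i ∈ A ↔ i ∈ B) →
      ∀ a ∈ B, ∀ i ∈ F, i ∈ initialPart e m A a ↔ i ∈ initialPart e m B a := by
  -- Only finitely many predecessors of `a` can precede `b` under `e a`; fixing these coordinates
  -- fixes the rank of `b`.
  have hfin (a b : X) : {c | c < a ∧ e a c < e a b}.Finite := by
    refine Set.Finite.of_finite_image ((Set.finite_lt_nat (e a b)).subset ?_)
      ((he a).mono fun c hc => hc.1)
    rintro _ ⟨c, hc, rfl⟩
    exact hc.2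
  refine ⟨B ∪ B.biUnion fun a => B.biUnion fun b => (hfin a b).toFinset,
    Finset.subset_union_left, fun A hA a ha i hi => ?_⟩
  simp only [initialPart, Finset.mem_filter, hA i hi]
  refine and_congr_right fun hiB => and_congr_right fun _ => ?_
  have : {c ∈ A | c < a ∧ e a c < e a i} = {c ∈ B | c < a ∧ e a c < e a i} := by
    ext c
    simp only [Finset.mem_filter]
    refine and_congr_left fun hc => hA c (Finset.mem_union_right _ ?_)
    exact Finset.mem_biUnion.2 ⟨a, ha, Finset.mem_biUnion.2 ⟨i, hiB, by simpa using hc⟩⟩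
  rw [this]

theorem continuous_ladderSum (hm : 1 ≤ m) (he : ∀ a, Set.InjOn (e a) {b | b < a}) (n : ℕ)
    (f : C(sigmaSpace m X, ℝ)) :
    Continuous fun x : sigmaSpace n X => ladderSum e m f (sigmaSupport x) := by
  rw [Metric.continuous_iff']
  intro x ε hε
  have hδ : 0 < ε / (2 * n + 1) := by positivity
  set δ := ε / (2 * n + 1) with hδ'
  obtain ⟨G, hG⟩ := exists_finset_dist_lt f hδ
  have hval {s t : Finset X} (hs : s.card ≤ m) (ht : t.card ≤ m) (h : ∀ i ∈ G, i ∈ s ↔ i ∈ t) :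
      |sigmaValue f s - sigmaValue f t| ≤ δ := by
    rw [sigmaValue_of_card_le f hs, sigmaValue_of_card_le f ht]
    exact (hG _ _ fun i hi => finsetChar_apply_eq_iff.2 (h i hi)).le
  have hI (A : Finset X) (a : X) : (initialPart e m A a).card ≤ m :=
    (card_initialPart_le m he A a).trans (Nat.sub_le _ _)
  -- Here `1 ≤ m` is needed; the default value of `sigmaValue` thus never enters.
  have hI' (A : Finset X) (a : X) : (insert a (initialPart e m A a)).card ≤ m := by
    have h1 := card_initialPart_le m he A a
    have h2 := Finset.card_insert_le a (initialPart e m A a)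
    omega
  set B := sigmaSupport x
  obtain ⟨F, hBF, hF⟩ := exists_finset_initialPart (m := m) he B
  filter_upwards [cylinder_mem_nhds x (F ∪ G)] with y hy
  set A := sigmaSupport y with hA
  have hAB : ∀ i ∈ F ∪ G, i ∈ A ↔ i ∈ B := fun i hi => by
    rw [mem_sigmaSupport, mem_sigmaSupport, hy i hi]
  have hBA : B ⊆ A := fun i hi => (hAB i (Finset.mem_union_left _ (hBF hi))).2 hi
  have hZ : ∀ a ∈ B, ∀ i ∈ G, i ∈ initialPart e m A a ↔ i ∈ initialPart e m B a := by
    intro a ha i hi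
    by_cases hiF : i ∈ F
    · exact hF A (fun j hj => hAB j (Finset.mem_union_left _ hj)) a ha i hiF
    · have hiB : i ∉ B := fun h => hiF (hBF h)
      have hiA : i ∉ A := fun h => hiB ((hAB i (Finset.mem_union_right _ hi)).1 h)
      exact iff_of_false (fun h => hiA (initialPart_subset e m A a h))
        fun h => hiB (initialPart_subset e m B a h)
  set τ : Finset X → X → ℝ := fun A a =>
    sigmaValue f (insert a (initialPart e m A a)) - sigmaValue f (initialPart e m A a) with hτ
  have hold : ∀ a ∈ B, |τ A a - τ B a| ≤ 2 * δ := fun a ha => by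
    have h1 := abs_le.1 (hval (hI A a) (hI B a) (hZ a ha))
    have h2 := abs_le.1 (hval (hI' A a) (hI' B a) fun i hi => by
      rw [Finset.mem_insert, Finset.mem_insert, hZ a ha i hi])
    simp only [hτ, abs_le]
    constructor <;> linarith [h1.1, h1.2, h2.1, h2.2]
  -- A new element lies outside `G`, so inserting it barely changes `f`.
  have hnew : ∀ a ∈ A \ B, |τ A a| ≤ 2 * δ := fun a ha => by
    rw [Finset.mem_sdiff] at ha
    refine (hval (hI' A a) (hI A a) fun i hi => ?_).trans (by linarith)
    rw [Finset.mem_insert, or_iff_right]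
    rintro rfl
    exact ha.2 ((hAB i (Finset.mem_union_right _ hi)).1 ha.1)
  have hdiff : ladderSum e m f A - ladderSum e m f B =
      ∑ a ∈ A \ B, τ A a + ∑ a ∈ B, (τ A a - τ B a) := by
    rw [Finset.sum_sub_distrib (τ A), ← add_sub_assoc, Finset.sum_sdiff hBA]
    simp only [ladderSum, hτ]
    ring
  have hn : ((A \ B).card : ℝ) + B.card ≤ n := by
    have := card_sigmaSupport_le y
    rw [← hA, ← Finset.card_sdiff_add_card_eq_card hBA] at this
    exact_mod_cast this
  rw [Real.dist_eq, hdiff]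
  calc |∑ a ∈ A \ B, τ A a + ∑ a ∈ B, (τ A a - τ B a)|
      ≤ (A \ B).card • (2 * δ) + B.card • (2 * δ) :=
        (abs_add_le _ _).trans (add_le_add
          ((Finset.abs_sum_le_sum_abs _ _).trans (Finset.sum_le_card_nsmul _ _ _ hnew))
          ((Finset.abs_sum_le_sum_abs _ _).trans (Finset.sum_le_card_nsmul _ _ _ hold)))
    _ = (((A \ B).card : ℝ) + B.card) * (2 * δ) := by simp only [nsmul_eq_mul]; ring
    _ ≤ n * (2 * δ) := by gcongr
    _ < (2 * n + 1) * δ := by linarith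
    _ = ε := by rw [hδ']; field_simp

theorem exists_extensionOperator_of_injOn (hm : 1 ≤ m) (he : ∀ a, Set.InjOn (e a) {b | b < a})
    {n : ℕ} (hmn : m ≤ n) :
    ∃ T : C(sigmaSpace m X, ℝ) →L[ℝ] C(sigmaSpace n X, ℝ),
      IsExtensionOperator (sigmaSpace_mono hmn X) T ∧
      ‖T‖ ≤ 2 * (n : ℝ) - 2 * (m : ℝ) + 1 := by
  have hmn' : (m : ℝ) ≤ n := by exact_mod_cast hmn
  let T₀ : C(sigmaSpace m X, ℝ) →ₗ[ℝ] C(sigmaSpace n X, ℝ) :=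
    { toFun := fun f => ⟨_, continuous_ladderSum hm he n f⟩
      map_add' := fun f g => by
        ext x
        simp only [ladderSum, sigmaValue_add, ContinuousMap.coe_mk, ContinuousMap.add_apply,
          Finset.sum_sub_distrib, Finset.sum_add_distrib]
        ring
      map_smul' := fun c f => by
        ext x
        simp only [ladderSum, sigmaValue_smul, ContinuousMap.coe_mk, ContinuousMap.smul_apply,
          smul_eq_mul, RingHom.id_apply, ← mul_sub, ← Finset.mul_sum, mul_add] }
  have hbound (f : C(sigmaSpace m X, ℝ)) : ‖T₀ f‖ ≤ (2 * (n : ℝ) - 2 * m + 1) * ‖f‖ := by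
    refine (ContinuousMap.norm_le _ (mul_nonneg (by linarith) (norm_nonneg _))).2 fun x => ?_
    have h := abs_ladderSum_le e m f (A := sigmaSupport x) (k := n - m)
      (by have := card_sigmaSupport_le x; omega)
    rw [Nat.cast_sub hmn] at h
    rw [Real.norm_eq_abs]
    exact h.trans_eq (by ring)
  refine ⟨T₀.mkContinuous _ hbound, fun f x => ?_, T₀.mkContinuous_norm_le (by linarith) hbound⟩
  have hs : sigmaSupport (Set.inclusion (sigmaSpace_mono hmn X) x) = sigmaSupport x := by
    ext i; simp only [mem_sigmaSupport]
  change ladderSum e m f (sigmaSupport (Set.inclusion (sigmaSpace_mono hmn X) x)) = f x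
  rw [hs, ladderSum_of_card_le e m f (card_sigmaSupport_le x),
    sigmaValue_of_card_le f (card_sigmaSupport_le x)]
  congr 1
  exact Subtype.ext (finsetChar_sigmaSupport x)

end Ladder

/-! ### Sets of cardinality `ℵ₁` and the conclusion. -/

theorem exists_linearOrder_countable_Iio {X : Type*} (hX : Cardinal.mk X = Cardinal.aleph 1) :
    ∃ _ : LinearOrder X, ∀ a : X, {b | b < a}.Countable := by
  obtain ⟨_, _, hrX⟩ := Cardinal.exists_ord_eq_type_lt X
  refine ⟨inferInstance, fun a => ?_⟩
  have h : Cardinal.mk {b | b < a} < Cardinal.aleph 1 := by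
    rw [← hX]
    exact Cardinal.mk_Iio_lt a hrX
  rw [← Cardinal.le_aleph0_iff_set_countable, ← Order.lt_succ_iff, Cardinal.succ_aleph0]
  exact h

theorem exists_extensionOperator {X : Type*} (hX : Cardinal.mk X = Cardinal.aleph 1) {m n : ℕ}
    (hm : 1 ≤ m) (hmn : m ≤ n) :
    ∃ T : C(sigmaSpace m X, ℝ) →L[ℝ] C(sigmaSpace n X, ℝ),
      IsExtensionOperator (sigmaSpace_mono hmn X) T ∧
      ‖T‖ ≤ 2 * (n : ℝ) - 2 * (m : ℝ) + 1 := by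
  obtain ⟨_, hc⟩ := exists_linearOrder_countable_Iio hX
  choose e he using fun a => Set.countable_iff_exists_injOn.1 (hc a)
  exact exists_extensionOperator_of_injOn hm he hmn

theorem mainTheorem2 {X : Type*} {m n : ℕ} (hm : 1 ≤ m) (hmn : m < n) :
    (Cardinal.mk X = Cardinal.aleph 1 →
      eta (sigmaSpace_mono hmn.le X) = ENNReal.ofReal (2 * (n : ℝ) - 2 * (m : ℝ) + 1) ∧
      ∃ T : C(sigmaSpace m X, ℝ) →L[ℝ] C(sigmaSpace n X, ℝ),
        IsExtensionOperator (sigmaSpace_mono hmn.le X) T ∧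
        ‖T‖ = 2 * (n : ℝ) - 2 * (m : ℝ) + 1) ∧
    (Uncountable X →
      ∀ T : C(sigmaSpace m X, ℝ) →L[ℝ] C(sigmaSpace n X, ℝ),
        IsExtensionOperator (sigmaSpace_mono hmn.le X) T →
        2 * (n : ℝ) - 2 * (m : ℝ) + 1 ≤ ‖T‖) := by
  refine ⟨fun hX => ?_, fun _ T hT => extensionOperator_norm_ge hm hmn T hT⟩
  have : Uncountable X := by
    rw [← Cardinal.aleph0_lt_mk_iff, hX]
    exact Cardinal.aleph0_lt_aleph_one
  obtain ⟨T, hT, hle⟩ := exists_extensionOperator hX hm hmn.le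
  have hnorm := hle.antisymm (extensionOperator_norm_ge hm hmn T hT)
  refine ⟨le_antisymm ?_ ?_, T, hT, hnorm⟩
  · refine (iInf₂_le T hT).trans_eq ?_
    rw [← hnorm, ← ofReal_norm]
  · refine le_iInf₂ fun S hS => ?_
    rw [← ofReal_norm]
    exact ENNReal.ofReal_le_ofReal (extensionOperator_norm_ge hm hmn S hS)
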